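/- Conventions. A state on $\mathbb{C}^d$ is a positive semidefinite $d\times d$ matrix of trace $1$; a channel is a completely positive trace-preserving linear map on matrices. For $\gamma\ge 1$ let $E_\gamma(\rho\|\sigma)=\operatorname{Tr}(\rho-\gamma\sigma)^+$ be the hockey-stick divergence and $\eta_\gamma(\mathcal{T})=\sup_{\rho,\sigma} E_\gamma(\mathcal{T}(\rho)\|\mathcal{T}(\sigma))/E_\gamma(\rho\|\sigma)$ its contraction coefficient, the supremum being over states with $E_\gamma(\rho\|\sigma)\neq 0$ (and $0$ if there are none). $\mathcal{N}^\dagger$ is the adjoint of $\mathcal{N}$ for the Hilbert–Schmidt inner product, $C_{\mathcal{M}}=\sum_{i,j}\mathcal{M}(|i\rangle\langle j|)\otimes|i\rangle\langle j|$ is the Choi matrix of $\mathcal{M}$, and $\lambda_{\min}$ denotes the smallest eigenvalue. A channel $\mathcal{A}$ is $(\epsilon,\delta)$-differentially private on a set $D$ of states, for a neighbouring relation $\sim$, if $\operatorname{Tr}(M\mathcal{A}(\rho))\le e^\epsilon\operatorname{Tr}(M\mathcal{A}(\sigma))+\delta$ for all $0\le M\le 1$ and all $\rho,\sigma\in D$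 with $\rho\sim\sigma$. Lemma (arbitrary local qubit noise). Let $\mathcal{N}$ be a qubit channel (input and output dimension $2$) and $\lambda=\lambda_{\min}(C_{\mathcal{N}^\dagger\circ\mathcal{N}})$. For $k\in\mathbb{N}$ and $\gamma\ge 1$ put $$b_k(\gamma)=\frac12\sqrt{(1+\gamma)^2-4\gamma\left(\frac{\lambda}{4}\right)^k}+\frac{1-\gamma}{2}.$$ 1. For all $k\in\mathbb{N}$ and $\gamma\ge1$, the supremum defining $\eta_\gamma(\mathcal{N}^{\otimes k})$ is finite and $\eta_\gamma(\mathcal{N}^{\otimes k})\le b_k(\gamma)$. 2. If $\mathcal{N}$ is non-unital, i.e. $\mathcal{N}(1)\neq 1$, then $\lambda>0$. 3. Let $k,n\in\mathbb{N}$, $\epsilon\ge0$, $\kappa\in\mathbb{R}$, let $\mathcal{C}_1,\dots,\mathcal{C}_n$ be channels on $k$ qubits, and let $D$ be a set of $k$-qubit states, where $\rho\sim\sigma$ means $\frac12\|\rho-\sigma\|_1\le\kappa$. Then the depth-$n$ circuit $\mathcal{A}=(\mathcal{N}^{\otimes k}\circ\mathcal{C}_n)\circ\cdots\circ(\mathcal{N}^{\otimes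 k}\circ\mathcal{C}_1)$ is $(\epsilon,\delta)$-differentially private on $D$ with $\delta=b_k(e^\epsilon)^n\,\kappa$. 4. If $\mathcal{N}$ is non-unital, then $0\le b_k(e^\epsilon)<1$ for all $k\in\mathbb{N}$ and $\epsilon\ge0$, so this $\delta$ decays exponentially in the depth $n$. -/

import Mathlib

open scoped Kronecker ComplexOrder

noncomputable section

namespace QPrivacy

variable {d : Type*} [Fintype d] [DecidableEq d]

/-- Linear maps on the operators of the Hilbert space `ℂ^d`. -/
abbrev SuperOp (d : Type*) : Type _ := Matrix d d ℂ →ₗ[ℂ] Matrix d d ℂ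

/-- Quantum states (density matrices) on `ℂ^d`. -/
def IsState (ρ : Matrix d d ℂ) : Prop := ρ.PosSemidef ∧ ρ.trace = 1

/-- The ampliation `id_m ⊗ Φ`, i.e. `Φ` applied to every `d × d` block. -/
def ampliation (m : ℕ) (Φ : SuperOp d) (X : Matrix (Fin m × d) (Fin m × d) ℂ) :
    Matrix (Fin m × d) (Fin m × d) ℂ :=
  Matrix.of fun p q => Φ (Matrix.of fun a b => X (p.1, a) (q.1, b)) p.2 q.2

/-- Complete positivity: every ampliation is positive. -/
def IsCompletelyPositive (Φ : SuperOp d) : Prop :=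
  ∀ (m : ℕ) (X : Matrix (Fin m × d) (Fin m × d) ℂ), X.PosSemidef → (ampliation m Φ X).PosSemidef

/-- Quantum channels: completely positive trace-preserving linear maps. -/
def IsChannel (Φ : SuperOp d) : Prop :=
  IsCompletelyPositive Φ ∧ ∀ X : Matrix d d ℂ, (Φ X).trace = X.trace

/-- The tensor power `Φ^{⊗k}` on the operators of `(ℂ^d)^{⊗k} = ℂ^(d^k)`, the linear map with
`|i⟩⟨j| ↦ Φ(|i₁⟩⟨j₁|) ⊗ ⋯ ⊗ Φ(|i_k⟩⟨j_k|)`. -/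
def tensorPower (Φ : SuperOp d) (k : ℕ) : SuperOp (Fin k → d) where
  toFun X := Matrix.of fun a b => ∑ i : Fin k → d, ∑ j : Fin k → d,
    X i j * ∏ l : Fin k, Φ (Matrix.single (i l) (j l) 1) (a l) (b l)
  map_add' X Y := by
    ext a b
    simp [add_mul, Finset.sum_add_distrib]
  map_smul' c X := by
    ext a b
    simp [Finset.mul_sum, mul_assoc]

/-- The adjoint `Φ†` for the Hilbert–Schmidt inner product `⟨X, Y⟩ = Tr (Xᴴ Y)`. -/
def hsAdjoint (Φ : SuperOp d) : SuperOp d where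
  toFun Y := Matrix.of fun i j => ((Φ (Matrix.single i j 1)).conjTranspose * Y).trace
  map_add' X Y := by
    ext a b
    simp [Matrix.mul_add]
  map_smul' c X := by
    ext a b
    simp

/-- The defining property of the adjoint. -/
theorem hsAdjoint_spec (Φ : SuperOp d) (X Y : Matrix d d ℂ) :
    (X.conjTranspose * hsAdjoint Φ Y).trace = ((Φ X).conjTranspose * Y).trace := by
  conv_rhs => rw [Matrix.matrix_eq_sum_single X]
  have h : ∀ i j, Matrix.single i j (X i j) = X i j • Matrix.single i j (1 : ℂ) := by
    intro i j
    simp [Matrix.smul_single]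
  simp only [h, map_sum, map_smul, Matrix.conjTranspose_sum, Matrix.conjTranspose_smul,
    Matrix.sum_mul, Matrix.trace_sum, Matrix.smul_mul, Matrix.trace_smul]
  rw [Matrix.trace, Finset.sum_comm]
  simp [Matrix.mul_apply, hsAdjoint, Matrix.conjTranspose_apply]

/-- The (unnormalised) Choi matrix `∑_{i,j} Φ(|i⟩⟨j|) ⊗ |i⟩⟨j|`. -/
def choi (Φ : SuperOp d) : Matrix (d × d) (d × d) ℂ :=
  ∑ i : d, ∑ j : d, Φ (Matrix.single i j 1) ⊗ₖ Matrix.single i j (1 : ℂ)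

/-- The smallest eigenvalue of a Hermitian matrix; `spectrum ℝ A` is the set of its real
eigenvalues, which is finite. -/
def minEigenvalue (A : Matrix d d ℂ) : ℝ := sInf (spectrum ℝ A)

theorem isLeast_minEigenvalue [Nonempty d] (A : Matrix d d ℂ) (hA : A.IsHermitian) :
    IsLeast (spectrum ℝ A) (minEigenvalue A) := by
  have hne : (spectrum ℝ A).Nonempty := by
    rw [hA.spectrum_real_eq_range_eigenvalues]
    exact Set.range_nonempty _
  have hfin : (spectrum ℝ A).Finite := A.finite_real_spectrum
  exact ⟨hne.csInf_mem hfin, fun x hx => csInf_le hfin.bddBelow hx⟩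

/-- The quantum hockey-stick divergence `E_γ(ρ‖σ) = Tr (ρ - γ σ)⁺`. -/
def hockeyStick (γ : ℝ) (ρ σ : Matrix d d ℂ) : ℝ :=
  ((ρ - γ • σ)⁺).trace.re

/-- The quotients `E_γ(Φ ρ‖Φ σ) / E_γ(ρ‖σ)`, over states with `E_γ(ρ‖σ) ≠ 0`. -/
def contractionRatios (γ : ℝ) (Φ : SuperOp d) : Set ℝ :=
  {r | ∃ ρ σ : Matrix d d ℂ, IsState ρ ∧ IsState σ ∧ hockeyStick γ ρ σ ≠ 0 ∧
    r = hockeyStick γ (Φ ρ) (Φ σ) / hockeyStick γ ρ σ}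

/-- The contraction coefficient `η_γ(Φ)` of the hockey-stick divergence. -/
def contractionCoeff (γ : ℝ) (Φ : SuperOp d) : ℝ := sSup (contractionRatios γ Φ)

/-- The trace norm `‖A‖₁ = Tr √(Aᴴ A)`. -/
def traceNorm (A : Matrix d d ℂ) : ℝ := (cfc Real.sqrt (A.conjTranspose * A)).trace.re

/-- `(ε, δ)`-differential privacy of `Φ` on a database `D` of states, with neighbours given by
`nbr`; `M` ranges over the measurement operators `0 ≤ M ≤ 1`. -/
def IsDifferentiallyPrivate (D : Set (Matrix d d ℂ)) (nbr : Matrix d d ℂ → Matrix d d ℂ → Prop)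
    (ε δ : ℝ) (Φ : SuperOp d) : Prop :=
  ∀ M : Matrix d d ℂ, M.PosSemidef → (1 - M).PosSemidef →
    ∀ ρ ∈ D, ∀ σ ∈ D, nbr ρ σ →
      (M * Φ ρ).trace.re ≤ Real.exp ε * (M * Φ σ).trace.re + δ

/-- `n` layers `C_i`, each followed by the noise `T`: `(T ∘ C_{n-1}) ∘ ⋯ ∘ (T ∘ C_0)`. -/
def layered (T : SuperOp d) (C : ℕ → SuperOp d) : ℕ → SuperOp d
  | 0 => LinearMap.id
  | n + 1 => T ∘ₗ C n ∘ₗ layered T C n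

end QPrivacy

end

noncomputable section

namespace QPrivacy

/-! Two outputs of the noise always overlap, and overlapping states cannot be told apart well. If
`Tr(ρσ) ≥ x`, the Frobenius norm applied to square roots of `ρ`, `σ` and of an effect `M` bounds `x`
by the classical fidelity of the outcome distributions; a double-angle identity then bounds `Tr M(ρ
- γσ)` (`effect_trace_sub_le`). Splitting `ρ - γσ` into positive and negative parts turns such a
bound over all pairs of states into a contraction factor (`hockeyStick_map_le`).

The overlap of two outputs of `N^{⊗k}` is the pairing of the `k`-th tensor power of the Choi matrix
of `N† ∘ N` with `ρᵀ ⊗ σ`, which has trace one, so it is at least `λ^k`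
(`pow_le_trace_tensorPower_mul`). This is stronger than the required `(λ/4)^k`.

If `λ = 0`, a kernel vector of the Choi matrix, read as a matrix `X`, makes all `K_r X K_s†`
traceless. Anticommutators of traceless 2 × 2 matrices are scalar, which forces `N` to be unital
(`map_one_eq_one_of_trace_eq_zero`). Privacy follows by iterating the contraction, with data
processing for the channels in between. -/

/-! ### Positive parts and effects -/

open scoped MatrixOrder in
theorem posPart_posSemidef {d : Type*} [Fintype d] [DecidableEq d] (A : Matrix d d ℂ) :
    (A⁺).PosSemidef := Matrix.nonneg_iff_posSemidef.1 (CFC.posPart_nonneg A)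

open scoped MatrixOrder in
theorem negPart_posSemidef {d : Type*} [Fintype d] [DecidableEq d] (A : Matrix d d ℂ) :
    (A⁻).PosSemidef := Matrix.nonneg_iff_posSemidef.1 (CFC.negPart_nonneg A)

theorem trace_mul_re_nonneg {d : Type*} [Fintype d] [DecidableEq d] {A B : Matrix d d ℂ}
    (hA : A.PosSemidef) (hB : B.PosSemidef) : 0 ≤ (A * B).trace.re := by
  open scoped MatrixOrder in
  obtain ⟨S, rfl⟩ := CStarAlgebra.nonneg_iff_eq_star_mul_self.mp (Matrix.nonneg_iff_posSemidef.2 hA)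
  have := (hB.mul_mul_conjTranspose_same S).trace_nonneg
  rw [Matrix.star_eq_conjTranspose, Matrix.mul_assoc, Matrix.trace_mul_comm]
  exact (Complex.le_def.1 this).1

/-- The projection onto the positive part of a Hermitian matrix is an optimal measurement. -/
theorem exists_effect_mul_eq_posPart {d : Type*} [Fintype d] [DecidableEq d] {A : Matrix d d ℂ}
    (hA : A.IsHermitian) :
    ∃ M : Matrix d d ℂ, M.PosSemidef ∧ (1 - M).PosSemidef ∧ M * A = A⁺ := by
  have hsa : IsSelfAdjoint A := hA
  have hc : ∀ f : ℝ → ℝ, ContinuousOn f (spectrum ℝ A) := fun f =>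
    A.finite_real_spectrum.continuousOn f
  let f : ℝ → ℝ := fun x => if 0 < x then 1 else 0
  refine ⟨cfc f A, ?_, ?_, ?_⟩
  · open scoped MatrixOrder in
    refine Matrix.nonneg_iff_posSemidef.1 (cfc_nonneg fun x _ => ?_)
    simp only [f]; split_ifs <;> norm_num
  · open scoped MatrixOrder in
    refine Matrix.le_iff.1 (cfc_le_one f A fun x _ => ?_)
    simp only [f]; split_ifs <;> norm_num
  · rw [CFC.posPart_def, cfcₙ_eq_cfc]
    have h : cfc f A * A = cfc (fun x => f x * x) A := by
      rw [cfc_mul f _ A (hc _) (hc _), cfc_id' ℝ A]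
    rw [h]
    refine cfc_congr fun x _ => ?_
    simp only [f, posPart_def]
    split_ifs with h
    · simp [h.le]
    · simp [not_lt.1 h]

theorem trace_effect_mul_le {d : Type*} [Fintype d] [DecidableEq d] {A M : Matrix d d ℂ}
    (hA : A.IsHermitian) (hM : M.PosSemidef) (hM' : (1 - M).PosSemidef) :
    (M * A).trace.re ≤ (A⁺).trace.re := by
  have h1 := trace_mul_re_nonneg hM (negPart_posSemidef A)
  have h2 := trace_mul_re_nonneg hM' (posPart_posSemidef A)
  have h3 : A⁺ - A⁻ = A := CFC.posPart_sub_negPart A hA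
  have h4 : M * A = A⁺ - (1 - M) * A⁺ - M * A⁻ := by
    conv_lhs => rw [← h3]
    noncomm_ring
  rw [h4]
  simp only [Matrix.trace_sub, Complex.sub_re]
  linarith

/-! ### Overlap, fidelity and distinguishability -/

section Frobenius

open scoped Matrix.Norms.Frobenius

theorem frobenius_norm_sq_eq_trace {m n : Type*} [Fintype m] [Fintype n] (A : Matrix m n ℂ) :
    ‖A‖ ^ 2 = (A.conjTranspose * A).trace.re := by
  rw [Matrix.frobenius_norm_def, ← Real.rpow_natCast, ← Real.rpow_mul (by positivity)]
  simp only [Matrix.trace, Matrix.diag_apply, Matrix.mul_apply, Matrix.conjTranspose_apply,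
    Complex.re_sum]
  rw [Finset.sum_comm]
  simp [← Complex.normSq_eq_conj_mul_self, Complex.normSq_eq_norm_sq, -Complex.ofReal_pow]

/-- The overlap of two states is at most the classical fidelity of the outcome distributions of
any two-outcome measurement. -/
theorem trace_mul_le_classical_fidelity {d : Type*} [Fintype d] [DecidableEq d]
    {ρ σ M : Matrix d d ℂ} (hρ : ρ.PosSemidef) (hσ : σ.PosSemidef)
    (hM : M.PosSemidef) (hM' : (1 - M).PosSemidef) :
    ∃ a b a' b' : ℝ, 0 ≤ a ∧ 0 ≤ b ∧ 0 ≤ a' ∧ 0 ≤ b' ∧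
      a ^ 2 = (M * ρ).trace.re ∧ b ^ 2 = (M * σ).trace.re ∧
      a' ^ 2 = ((1 - M) * ρ).trace.re ∧ b' ^ 2 = ((1 - M) * σ).trace.re ∧
      (ρ * σ).trace.re ≤ (a * b + a' * b') ^ 2 := by
  have key : ∀ B : Matrix d d ℂ, B.PosSemidef → ∃ S : Matrix d d ℂ, B = S.conjTranspose * S := by
    intro B hB
    open scoped MatrixOrder in
    exact CStarAlgebra.nonneg_iff_eq_star_mul_self.mp (Matrix.nonneg_iff_posSemidef.2 hB)
  obtain ⟨R, rfl⟩ := key ρ hρ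
  obtain ⟨S, rfl⟩ := key σ hσ
  obtain ⟨m, hm⟩ := key M hM
  obtain ⟨m', hm'⟩ := key _ hM'
  have hn : ∀ m R : Matrix d d ℂ, ‖m * R.conjTranspose‖ ^ 2 =
      ((m.conjTranspose * m) * (R.conjTranspose * R)).trace.re := by
    intro m R
    rw [frobenius_norm_sq_eq_trace, Matrix.conjTranspose_mul, Matrix.conjTranspose_conjTranspose,
      Matrix.mul_assoc, Matrix.trace_mul_comm]
    simp only [Matrix.mul_assoc]
  refine ⟨‖m * R.conjTranspose‖, ‖m * S.conjTranspose‖, ‖m' * R.conjTranspose‖,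
    ‖m' * S.conjTranspose‖, norm_nonneg _, norm_nonneg _, norm_nonneg _, norm_nonneg _,
    ?_, ?_, ?_, ?_, ?_⟩
  · rw [hn, hm]
  · rw [hn, hm]
  · rw [hn, hm']
  · rw [hn, hm']
  rw [← hn]
  -- Inserting `1 = m†m + m'†m'` between `R` and `S†` splits the overlap by outcome; the triangle
  -- inequality and submultiplicativity of the Frobenius norm finish.
  have h1 : R * S.conjTranspose = (m * R.conjTranspose).conjTranspose * (m * S.conjTranspose) +
      (m' * R.conjTranspose).conjTranspose * (m' * S.conjTranspose) := by
    have : (1 : Matrix d d ℂ) = m.conjTranspose * m + m'.conjTranspose * m' := by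
      rw [← hm, ← hm']; abel
    simp only [Matrix.conjTranspose_mul, Matrix.conjTranspose_conjTranspose]
    calc R * S.conjTranspose = R * 1 * S.conjTranspose := by simp
      _ = _ := by rw [this]; noncomm_ring
  rw [h1]
  gcongr
  refine (norm_add_le _ _).trans (add_le_add ?_ ?_)
  · refine (Matrix.frobenius_norm_mul _ _).trans_eq ?_
    rw [Matrix.frobenius_norm_conjTranspose]
  · refine (Matrix.frobenius_norm_mul _ _).trans_eq ?_
    rw [Matrix.frobenius_norm_conjTranspose]

end Frobenius

/-- Double angles: `u = (a² - a'², 2aa')` and `v = (b² - b'², 2bb')` are unit vectors with `u·v =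
2(ab + a'b')² - 1`. The squared quantity on the left is the first coordinate of `u - γv`, so it is
at most `|u - γv|²`. -/
theorem classical_hockeyStick_sq_le {γ x a b a' b' : ℝ} (hγ : 0 ≤ γ)
    (hab : a ^ 2 + a' ^ 2 = 1) (hb : b ^ 2 + b' ^ 2 = 1)
    (hx : x ≤ (a * b + a' * b') ^ 2) :
    (2 * (a ^ 2 - γ * b ^ 2) + γ - 1) ^ 2 ≤ (1 + γ) ^ 2 - 4 * γ * x := by
  have h1 : (2 * (a ^ 2 - γ * b ^ 2) + γ - 1) ^ 2 + (2 * a * a' - 2 * γ * b * b') ^ 2 =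
      (1 + γ) ^ 2 - 4 * γ * (a * b + a' * b') ^ 2 := by
    have e1 : a' ^ 2 = 1 - a ^ 2 := by linarith
    have e2 : b' ^ 2 = 1 - b ^ 2 := by linarith
    linear_combination (4 * a ^ 2 + 4 * γ * b' ^ 2) * e1 + (4 * γ ^ 2 * b ^ 2 +
      4 * γ * (1 - a ^ 2)) * e2
  nlinarith [sq_nonneg (2 * a * a' - 2 * γ * b * b'), mul_le_mul_of_nonneg_left hx hγ]

theorem effect_trace_sub_le {d : Type*} [Fintype d] [DecidableEq d] {ρ σ M : Matrix d d ℂ}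
    (hρ : IsState ρ) (hσ : IsState σ) (hM : M.PosSemidef) (hM' : (1 - M).PosSemidef)
    {γ x : ℝ} (hγ : 0 ≤ γ) (hx : x ≤ (ρ * σ).trace.re) :
    (M * ρ).trace.re - γ * (M * σ).trace.re ≤
      1 / 2 * Real.sqrt ((1 + γ) ^ 2 - 4 * γ * x) + (1 - γ) / 2 := by
  obtain ⟨a, b, a', b', -, -, -, -, ha, hb, ha', hb', h⟩ :=
    trace_mul_le_classical_fidelity hρ.1 hσ.1 hM hM'
  have e1 : a ^ 2 + a' ^ 2 = 1 := by
    rw [ha, ha', ← Complex.add_re, ← Matrix.trace_add, ← Matrix.add_mul]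
    simp [hρ.2]
  have e2 : b ^ 2 + b' ^ 2 = 1 := by
    rw [hb, hb', ← Complex.add_re, ← Matrix.trace_add, ← Matrix.add_mul]
    simp [hσ.2]
  have := Real.le_sqrt_of_sq_le (classical_hockeyStick_sq_le hγ e1 e2 (hx.trans h))
  rw [← ha, ← hb]
  linarith

/-! ### Contraction of the hockey-stick divergence -/

theorem IsState.sub_smul_isHermitian {d : Type*} [Fintype d] {ρ σ : Matrix d d ℂ}
    (hρ : IsState ρ) (hσ : IsState σ) (γ : ℝ) : (ρ - γ • σ).IsHermitian := by
  refine hρ.1.1.sub ?_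
  rw [Matrix.IsHermitian, Matrix.conjTranspose_smul, hσ.1.1.eq, star_trivial]

/-- Positive and trace preserving maps. -/
def IsPositiveTP {d : Type*} [Fintype d] (Φ : SuperOp d) : Prop :=
  (∀ X : Matrix d d ℂ, X.PosSemidef → (Φ X).PosSemidef) ∧ ∀ X, (Φ X).trace = X.trace

theorem IsPositiveTP.isState {d : Type*} [Fintype d] {Φ : SuperOp d}
    (hΦ : IsPositiveTP Φ) {ρ : Matrix d d ℂ} (hρ : IsState ρ) : IsState (Φ ρ) :=
  ⟨hΦ.1 _ hρ.1, (hΦ.2 _).trans hρ.2⟩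

theorem hockeyStick_nonneg {d : Type*} [Fintype d] [DecidableEq d] (γ : ℝ)
    (ρ σ : Matrix d d ℂ) : 0 ≤ hockeyStick γ ρ σ :=
  (Complex.le_def.1 (posPart_posSemidef _).trace_nonneg).1

theorem trace_effect_sub_le_hockeyStick {d : Type*} [Fintype d] [DecidableEq d]
    {ρ σ M : Matrix d d ℂ} (hρ : IsState ρ) (hσ : IsState σ) (hM : M.PosSemidef)
    (hM' : (1 - M).PosSemidef) (γ : ℝ) :
    (M * ρ).trace.re - γ * (M * σ).trace.re ≤ hockeyStick γ ρ σ := by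
  have := trace_effect_mul_le (hρ.sub_smul_isHermitian hσ γ) hM hM'
  simpa [Matrix.mul_sub, hockeyStick] using this

/-- An optimal measurement for the hockey-stick divergence. -/
theorem exists_effect_hockeyStick {d : Type*} [Fintype d] [DecidableEq d]
    {ρ σ : Matrix d d ℂ} (hρ : IsState ρ) (hσ : IsState σ) (γ : ℝ) :
    ∃ M : Matrix d d ℂ, M.PosSemidef ∧ (1 - M).PosSemidef ∧
      hockeyStick γ ρ σ = (M * ρ).trace.re - γ * (M * σ).trace.re := by
  obtain ⟨M, hM, hM', h⟩ := exists_effect_mul_eq_posPart (hρ.sub_smul_isHermitian hσ γ)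
  refine ⟨M, hM, hM', ?_⟩
  rw [hockeyStick, ← h]
  simp [Matrix.mul_sub]

theorem hockeyStick_le_one {d : Type*} [Fintype d] [DecidableEq d] {γ : ℝ} (hγ : 0 ≤ γ)
    {ρ σ : Matrix d d ℂ} (hρ : IsState ρ) (hσ : IsState σ) : hockeyStick γ ρ σ ≤ 1 := by
  obtain ⟨M, hM, hM', h⟩ := exists_effect_hockeyStick hρ hσ γ
  have h1 := trace_mul_re_nonneg hM' hρ.1
  have h2 := mul_nonneg hγ (trace_mul_re_nonneg hM hσ.1)
  rw [Matrix.sub_mul, Matrix.one_mul, Matrix.trace_sub, hρ.2, Complex.sub_re,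
    Complex.one_re] at h1
  linarith

theorem PosSemidef.exists_state_smul {d : Type*} [Fintype d] {P : Matrix d d ℂ}
    (hP : P.PosSemidef) (h : 0 < P.trace.re) :
    ∃ ρ, IsState ρ ∧ P = P.trace.re • ρ := by
  have him : P.trace = (P.trace.re : ℂ) :=
    Complex.ext (by simp) (by simpa using (Complex.le_def.1 hP.trace_nonneg).2.symm)
  refine ⟨P.trace.re⁻¹ • P, ⟨hP.smul (by positivity), ?_⟩, ?_⟩
  · rw [Matrix.trace_smul, Complex.real_smul]
    conv_lhs => rw [him]
    simp [h.ne']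
  · rw [smul_smul, mul_inv_cancel₀ h.ne', one_smul]

/-- A positive part/negative part decomposition of `ρ - γ σ` into multiples of states. -/
theorem exists_states_of_hockeyStick_ne_zero {d : Type*} [Fintype d] [DecidableEq d]
    {γ : ℝ} (hγ : 1 ≤ γ) {ρ σ : Matrix d d ℂ} (hρ : IsState ρ) (hσ : IsState σ)
    (h : hockeyStick γ ρ σ ≠ 0) :
    ∃ (P Q : Matrix d d ℂ) (q : ℝ), IsState P ∧ IsState Q ∧ γ * hockeyStick γ ρ σ ≤ q ∧
      ρ - γ • σ = hockeyStick γ ρ σ • P - q • Q := by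
  have he : 0 < hockeyStick γ ρ σ := lt_of_le_of_ne (hockeyStick_nonneg _ _ _) h.symm
  have he1 := hockeyStick_le_one (by linarith) hρ hσ (γ := γ)
  have hA : (ρ - γ • σ)⁺ - (ρ - γ • σ)⁻ = ρ - γ • σ :=
    CFC.posPart_sub_negPart _ (hρ.sub_smul_isHermitian hσ γ)
  have htr : hockeyStick γ ρ σ - ((ρ - γ • σ)⁻).trace.re = 1 - γ := by
    have := congrArg (fun X => (Matrix.trace X).re) hA
    simpa [hρ.2, hσ.2, hockeyStick] using this
  obtain ⟨P, hP, hP'⟩ := PosSemidef.exists_state_smul (posPart_posSemidef (ρ - γ • σ)) he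
  -- With `E` the divergence, the negative part has trace `E + γ - 1`, and `E + γ - 1 - γE = (γ -
  -- 1)(1 - E) ≥ 0`.
  have hq : γ * hockeyStick γ ρ σ ≤ ((ρ - γ • σ)⁻).trace.re := by nlinarith
  obtain ⟨Q, hQ, hQ'⟩ := PosSemidef.exists_state_smul (negPart_posSemidef (ρ - γ • σ))
    (lt_of_lt_of_le (by positivity) hq)
  refine ⟨P, Q, _, hP, hQ, hq, ?_⟩
  rw [← hQ', hockeyStick, ← hP', hA]

/-- Linearity and a bound on all pairs of states give contraction. -/
theorem hockeyStick_map_le {d : Type*} [Fintype d] [DecidableEq d] {Φ : SuperOp d}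
    (hΦ : IsPositiveTP Φ) {γ c : ℝ} (hγ : 1 ≤ γ)
    (hc : ∀ ρ σ M : Matrix d d ℂ, IsState ρ → IsState σ → M.PosSemidef → (1 - M).PosSemidef →
      (M * Φ ρ).trace.re - γ * (M * Φ σ).trace.re ≤ c)
    {ρ σ : Matrix d d ℂ} (hρ : IsState ρ) (hσ : IsState σ) :
    hockeyStick γ (Φ ρ) (Φ σ) ≤ c * hockeyStick γ ρ σ := by
  obtain ⟨M, hM, hM', hMe⟩ := exists_effect_hockeyStick (hΦ.isState hρ) (hΦ.isState hσ) γ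
  have hlin : ∀ X Y : Matrix d d ℂ, ∀ s t : ℝ, (M * Φ (s • X - t • Y)).trace.re =
      s * (M * Φ X).trace.re - t * (M * Φ Y).trace.re := by
    intro X Y s t
    simp [Matrix.mul_sub, ← Complex.coe_smul]
  have h0 : hockeyStick γ (Φ ρ) (Φ σ) = (M * Φ (ρ - γ • σ)).trace.re := by
    rw [hMe]
    simpa using (hlin ρ σ 1 γ).symm
  rw [h0]
  -- If the divergence vanishes, `ρ - γσ ≤ 0`, and positivity of `Φ` keeps the output difference
  -- nonpositive. Otherwise `q ≥ γE` allows `q` to be replaced by `γE`, which reduces to the bound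
  -- for the pair `P`, `Q`.
  by_cases h : hockeyStick γ ρ σ = 0
  · have hA : (ρ - γ • σ)⁺ - (ρ - γ • σ)⁻ = ρ - γ • σ :=
      CFC.posPart_sub_negPart _ (hρ.sub_smul_isHermitian hσ γ)
    have hp := posPart_posSemidef (ρ - γ • σ)
    have hp0 : (ρ - γ • σ)⁺ = 0 := by
      refine hp.trace_eq_zero_iff.1 (Complex.ext h ?_)
      simpa using (Complex.le_def.1 hp.trace_nonneg).2.symm
    rw [h, ← hA, hp0]
    have := trace_mul_re_nonneg hM (hΦ.1 _ (negPart_posSemidef (ρ - γ • σ)))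
    simpa using this
  · obtain ⟨P, Q, q, hP, hQ, hq, hA⟩ := exists_states_of_hockeyStick_ne_zero hγ hρ hσ h
    rw [hA, hlin]
    have h1 := trace_mul_re_nonneg hM (hΦ.isState hQ).1
    have h2 := mul_le_mul_of_nonneg_left (hc P Q M hP hQ hM hM') (hockeyStick_nonneg γ ρ σ)
    nlinarith [mul_le_mul_of_nonneg_right hq h1]

/-- Data processing for the hockey-stick divergence. -/
theorem hockeyStick_map_le_self {d : Type*} [Fintype d] [DecidableEq d] {Φ : SuperOp d}
    (hΦ : IsPositiveTP Φ) {γ : ℝ} (hγ : 1 ≤ γ)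
    {ρ σ : Matrix d d ℂ} (hρ : IsState ρ) (hσ : IsState σ) :
    hockeyStick γ (Φ ρ) (Φ σ) ≤ hockeyStick γ ρ σ := by
  have := hockeyStick_map_le hΦ hγ (c := 1) (fun ρ σ M hρ hσ hM hM' =>
    (trace_effect_sub_le_hockeyStick (hΦ.isState hρ) (hΦ.isState hσ) hM hM' γ).trans
      (hockeyStick_le_one (by linarith) (hΦ.isState hρ) (hΦ.isState hσ))) hρ hσ
  simpa using this

theorem traceNorm_eq_posPart_add_negPart {d : Type*} [Fintype d] [DecidableEq d]
    {A : Matrix d d ℂ} (hA : A.IsHermitian) :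
    traceNorm A = (A⁺).trace.re + (A⁻).trace.re := by
  have hsa : IsSelfAdjoint A := hA
  have hc : ∀ f : ℝ → ℝ, ContinuousOn f (spectrum ℝ A) := fun f =>
    A.finite_real_spectrum.continuousOn f
  have h1 : A.conjTranspose * A = cfc (fun x : ℝ => x * x) A := by
    rw [hA.eq, cfc_mul _ _ A (hc _) (hc _), cfc_id' ℝ A]
  have h2 : cfc Real.sqrt (A.conjTranspose * A) = A⁺ + A⁻ := by
    rw [h1, ← cfc_comp' Real.sqrt (fun x : ℝ => x * x) A, CFC.posPart_def, CFC.negPart_def,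
      cfcₙ_eq_cfc, cfcₙ_eq_cfc, ← cfc_add A _ _ (hc _) (hc _)]
    refine cfc_congr fun x _ => ?_
    simp [Real.sqrt_mul_self_eq_abs, posPart_add_negPart]
  rw [traceNorm, h2, Matrix.trace_add, Complex.add_re]

/-- Since `γ ≥ 1`, the divergence is at most its value at `γ = 1`; as `ρ - σ` is traceless, its
positive and negative parts each carry half the trace norm. -/
theorem hockeyStick_le_half_traceNorm {d : Type*} [Fintype d] [DecidableEq d] {γ : ℝ}
    (hγ : 1 ≤ γ) {ρ σ : Matrix d d ℂ} (hρ : IsState ρ) (hσ : IsState σ) :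
    hockeyStick γ ρ σ ≤ 1 / 2 * traceNorm (ρ - σ) := by
  have hH : (ρ - σ).IsHermitian := hρ.1.1.sub hσ.1.1
  obtain ⟨M, hM, hM', h⟩ := exists_effect_hockeyStick hρ hσ γ
  have h1 := trace_effect_mul_le hH hM hM'
  have h2 := trace_mul_re_nonneg hM hσ.1
  have h3 : ((ρ - σ)⁺).trace.re - ((ρ - σ)⁻).trace.re = 0 := by
    have := congrArg (fun X => (Matrix.trace X).re) (CFC.posPart_sub_negPart (ρ - σ) hH)
    simpa [hρ.2, hσ.2] using this
  rw [traceNorm_eq_posPart_add_negPart hH, h]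
  rw [Matrix.mul_sub, Matrix.trace_sub, Complex.sub_re] at h1
  nlinarith

/-! ### Kraus operators and tensor powers -/

theorem IsCompletelyPositive.posSemidef_map {d : Type*} [Fintype d] [DecidableEq d]
    {Φ : SuperOp d} (hΦ : IsCompletelyPositive Φ) {X : Matrix d d ℂ} (hX : X.PosSemidef) :
    (Φ X).PosSemidef :=
  (hΦ 1 (X.submatrix Prod.snd Prod.snd) (hX.submatrix _)).submatrix fun a => (0, a)

theorem IsChannel.isPositiveTP {d : Type*} [Fintype d] [DecidableEq d] {Φ : SuperOp d}
    (hΦ : IsChannel Φ) : IsPositiveTP Φ :=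
  ⟨fun _ hX => hΦ.1.posSemidef_map hX, hΦ.2⟩

theorem map_eq_sum_single {d e : Type*} [Fintype d] [DecidableEq d]
    (Φ : Matrix d d ℂ →ₗ[ℂ] Matrix e e ℂ) (X : Matrix d d ℂ) :
    Φ X = ∑ i, ∑ j, X i j • Φ (Matrix.single i j 1) := by
  conv_lhs => rw [Matrix.matrix_eq_sum_single X]
  simp only [map_sum, ← map_smul, Matrix.smul_single, smul_eq_mul, mul_one]

theorem mul_single_mul_conjTranspose_apply {d e : Type*} [Fintype d] [DecidableEq d]
    (A : Matrix e d ℂ) (i j : d) (a b : e) :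
    (A * Matrix.single i j (1 : ℂ) * A.conjTranspose) a b = A a i * star (A b j) := by
  simp [Matrix.mul_apply, Matrix.single_apply, ite_and, Finset.sum_ite_eq]

/-- Kraus representation of a completely positive map. -/
theorem IsCompletelyPositive.exists_kraus {m : ℕ} {Φ : SuperOp (Fin m)}
    (hΦ : IsCompletelyPositive Φ) :
    ∃ K : Fin m × Fin m → Matrix (Fin m) (Fin m) ℂ,
      ∀ X, Φ X = ∑ r, K r * X * (K r).conjTranspose := by
  -- The unnormalised maximally entangled vector: the ampliation of its projector is a Choi matrix,
  -- and the conjugated rows of a factor `B` of it are the Kraus operators.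
  let v : Fin m × Fin m → ℂ := fun p => if p.1 = p.2 then 1 else 0
  have h := hΦ m (Matrix.vecMulVec v (star v)) (Matrix.posSemidef_vecMulVec_self_star v)
  obtain ⟨B, hB⟩ : ∃ B, ampliation m Φ (Matrix.vecMulVec v (star v)) = star B * B := by
    open scoped MatrixOrder in
    exact CStarAlgebra.nonneg_iff_eq_star_mul_self.mp (Matrix.nonneg_iff_posSemidef.2 h)
  have hE : ∀ p q a b, Φ (Matrix.single p q 1) a b = ∑ r, star (B r (p, a)) * B r (q, b) := by
    intro p q a b
    have h1 := congrFun (congrFun hB (p, a)) (q, b)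
    have h2 : (Matrix.of fun a b => Matrix.vecMulVec v (star v) (p, a) (q, b)) =
        Matrix.single p q (1 : ℂ) := by
      ext x y
      simp only [v, Matrix.of_apply, Matrix.vecMulVec_apply, Pi.star_apply, Matrix.single_apply]
      split_ifs <;> simp_all
    rw [ampliation, Matrix.of_apply, h2] at h1
    rw [h1, Matrix.mul_apply]
    rfl
  refine ⟨fun r => Matrix.of fun a p => star (B r (p, a)), fun X => ?_⟩
  rw [map_eq_sum_single]
  ext a b
  simp only [Matrix.sum_apply, Matrix.smul_apply, hE, Matrix.mul_apply, Matrix.of_apply,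
    Matrix.conjTranspose_apply, star_star, smul_eq_mul, Finset.mul_sum, Finset.sum_mul]
  rw [Finset.sum_comm]
  refine (Finset.sum_congr rfl fun q _ => Finset.sum_comm).trans ?_
  rw [Finset.sum_comm]
  refine Finset.sum_congr rfl fun r _ => Finset.sum_congr rfl fun q _ =>
    Finset.sum_congr rfl fun p _ => ?_
  ring

theorem tensorPower_single {d : Type*} [Fintype d] [DecidableEq d] (Φ : SuperOp d) {k : ℕ}
    (i j a b : Fin k → d) :
    tensorPower Φ k (Matrix.single i j 1) a b =
      ∏ l, Φ (Matrix.single (i l) (j l) 1) (a l) (b l) := by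
  change ∑ i' : Fin k → d, ∑ j' : Fin k → d, Matrix.single i j (1 : ℂ) i' j' *
    ∏ l : Fin k, Φ (Matrix.single (i' l) (j' l) 1) (a l) (b l) = _
  simp [Matrix.single_apply, ite_and]

/-- Kraus operators of a tensor power. -/
theorem tensorPower_kraus {d ι : Type*} [Fintype d] [DecidableEq d] [Fintype ι]
    {Φ : SuperOp d} {K : ι → Matrix d d ℂ}
    (hK : ∀ X, Φ X = ∑ r, K r * X * (K r).conjTranspose) (k : ℕ)
    (X : Matrix (Fin k → d) (Fin k → d) ℂ) :
    tensorPower Φ k X = ∑ r : Fin k → ι, (Matrix.of fun a i => ∏ l, K (r l) (a l) (i l)) * X *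
      (Matrix.of fun a i => ∏ l, K (r l) (a l) (i l)).conjTranspose := by
  classical
  ext a b
  have hE : ∀ i j a b, Φ (Matrix.single i j 1) a b = ∑ r, K r a i * star (K r b j) := by
    intro i j a b
    rw [hK, Matrix.sum_apply]
    exact Finset.sum_congr rfl fun r _ => mul_single_mul_conjTranspose_apply _ _ _ _ _
  change ∑ i : Fin k → d, ∑ j : Fin k → d, X i j *
    ∏ l : Fin k, Φ (Matrix.single (i l) (j l) 1) (a l) (b l) = _
  simp only [hE, Finset.prod_univ_sum, Fintype.piFinset_univ, Finset.prod_mul_distrib,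
    Matrix.sum_apply, Matrix.mul_apply, Matrix.of_apply, Matrix.conjTranspose_apply,
    Finset.mul_sum, Finset.sum_mul, star_prod]
  rw [Finset.sum_comm]
  refine (Finset.sum_congr rfl fun q _ => Finset.sum_comm).trans ?_
  rw [Finset.sum_comm]
  refine Finset.sum_congr rfl fun r _ => Finset.sum_congr rfl fun q _ =>
    Finset.sum_congr rfl fun p _ => ?_
  ring

theorem tensorPower_isPositiveTP {m : ℕ} {Φ : SuperOp (Fin m)} (hΦ : IsChannel Φ) (k : ℕ) :
    IsPositiveTP (tensorPower Φ k) := by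
  obtain ⟨K, hK⟩ := hΦ.1.exists_kraus
  refine ⟨fun X hX => ?_, fun X => ?_⟩
  · rw [tensorPower_kraus hK]
    exact Matrix.posSemidef_sum _ fun r _ => hX.mul_mul_conjTranspose_same _
  · have h1 : ∀ i j : Fin k → Fin m,
        (tensorPower Φ k (Matrix.single i j 1)).trace = if i = j then 1 else 0 := by
      intro i j
      simp only [Matrix.trace, Matrix.diag_apply, tensorPower_single]
      rw [← Fintype.piFinset_univ, ← Finset.prod_univ_sum
        (fun _ => Finset.univ) fun l x => Φ (Matrix.single (i l) (j l) 1) x x]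
      have h2 : ∀ l, ∑ x, Φ (Matrix.single (i l) (j l) 1) x x = if i l = j l then 1 else 0 := by
        intro l
        have := hΦ.2 (Matrix.single (i l) (j l) 1)
        rw [Matrix.trace] at this
        simp only [Matrix.diag_apply] at this
        rw [this]
        split_ifs with h
        · rw [h]; simp
        · exact Matrix.trace_single_eq_of_ne _ _ _ h
      simp only [h2, Finset.prod_ite_zero, Finset.prod_const_one, Finset.mem_univ, true_imp_iff,
        funext_iff]
    rw [map_eq_sum_single]
    simp only [Matrix.trace_sum, Matrix.trace_smul, h1]
    simp [Matrix.trace]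

/-! ### The Choi matrix of `Φ† ∘ Φ` and the overlap of outputs -/

theorem choi_hsAdjoint_comp_apply {d : Type*} [Fintype d] [DecidableEq d] (Φ : SuperOp d)
    (a i b j : d) :
    choi (hsAdjoint Φ ∘ₗ Φ) (a, i) (b, j) =
      ((Φ (Matrix.single a b 1)).conjTranspose * Φ (Matrix.single i j 1)).trace := by
  simp [choi, Matrix.sum_apply, Matrix.kroneckerMap_apply, Matrix.single_apply, ite_and, hsAdjoint]

/-- `Φ† ∘ Φ` has Kraus operators `K_r† K_s`, and a Choi matrix is the sum of the rank-one matrices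
of its vectorised Kraus operators. -/
theorem choi_hsAdjoint_comp_eq_sum {d ι : Type*} [Fintype d] [DecidableEq d] [Fintype ι]
    {Φ : SuperOp d} {K : ι → Matrix d d ℂ}
    (hK : ∀ X, Φ X = ∑ r, K r * X * (K r).conjTranspose) :
    choi (hsAdjoint Φ ∘ₗ Φ) = ∑ r, ∑ s,
      Matrix.vecMulVec (fun p : d × d => ((K r).conjTranspose * K s) p.1 p.2)
        (star fun p : d × d => ((K r).conjTranspose * K s) p.1 p.2) := by
  ext ⟨a, i⟩ ⟨b, j⟩
  rw [choi_hsAdjoint_comp_apply, hK, hK, Matrix.conjTranspose_sum, Matrix.sum_mul,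
    Matrix.trace_sum, Matrix.sum_apply]
  refine Finset.sum_congr rfl fun r _ => ?_
  rw [Matrix.mul_sum, Matrix.trace_sum, Matrix.sum_apply]
  refine Finset.sum_congr rfl fun s _ => ?_
  have h : ((K r * Matrix.single a b 1 * (K r).conjTranspose).conjTranspose *
      (K s * Matrix.single i j 1 * (K s).conjTranspose)).trace =
      (Matrix.single b a 1 * (((K r).conjTranspose * K s) * Matrix.single i j 1 *
        ((K r).conjTranspose * K s).conjTranspose)).trace := by
    rw [Matrix.conjTranspose_mul, Matrix.conjTranspose_mul, Matrix.conjTranspose_conjTranspose,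
      Matrix.conjTranspose_single, star_one, Matrix.mul_assoc, Matrix.trace_mul_comm]
    simp only [Matrix.mul_assoc, Matrix.conjTranspose_mul, Matrix.conjTranspose_conjTranspose]
  rw [h, Matrix.trace_single_mul, mul_single_mul_conjTranspose_apply]
  simp [Matrix.vecMulVec_apply]

theorem choi_hsAdjoint_comp_posSemidef {m : ℕ} {Φ : SuperOp (Fin m)} (hΦ : IsChannel Φ) :
    (choi (hsAdjoint Φ ∘ₗ Φ)).PosSemidef := by
  obtain ⟨K, hK⟩ := hΦ.1.exists_kraus
  rw [choi_hsAdjoint_comp_eq_sum hK]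
  exact Matrix.posSemidef_sum _ fun r _ => Matrix.posSemidef_sum _ fun s _ =>
    Matrix.posSemidef_vecMulVec_self_star _

theorem minEigenvalue_nonneg {d : Type*} [Fintype d] [DecidableEq d] [Nonempty d]
    {A : Matrix d d ℂ} (hA : A.PosSemidef) : 0 ≤ minEigenvalue A := by
  open scoped MatrixOrder in
  exact spectrum_nonneg_of_nonneg (Matrix.nonneg_iff_posSemidef.2 hA)
    (isLeast_minEigenvalue A hA.1).1

theorem sub_minEigenvalue_posSemidef {d : Type*} [Fintype d] [DecidableEq d] [Nonempty d]
    {A : Matrix d d ℂ} (hA : A.IsHermitian) :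
    (A - minEigenvalue A • (1 : Matrix d d ℂ)).PosSemidef := by
  have hsa : IsSelfAdjoint A := hA
  open scoped MatrixOrder in
  refine Matrix.le_iff.1 ?_
  rw [← Algebra.algebraMap_eq_smul_one, algebraMap_le_iff_le_spectrum]
  exact (isLeast_minEigenvalue A hA).2

theorem prod_sub_pow_posSemidef {e : Type*} [Fintype e] [DecidableEq e] {C : Matrix e e ℂ}
    {t : ℝ} (ht : 0 ≤ t) (hC : (C - t • (1 : Matrix e e ℂ)).PosSemidef) (k : ℕ) :
    ((Matrix.of fun a b : Fin k → e => ∏ l, C (a l) (b l)) -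
      t ^ k • (1 : Matrix (Fin k → e) (Fin k → e) ℂ)).PosSemidef := by
  induction k with
  | zero =>
    convert Matrix.PosSemidef.zero using 1
    ext a b
    simp [Subsingleton.elim a b]
  | succ k ih =>
    set G : Matrix (Fin k → e) (Fin k → e) ℂ := Matrix.of fun a b => ∏ l, C (a l) (b l) with hG
    have hGp : G.PosSemidef := by
      have := ih.add (Matrix.PosSemidef.one.smul (pow_nonneg ht k))
      simpa using this
    -- Telescoping: `C ⊗ G - t^(k+1) = (C - t) ⊗ G + t (1 ⊗ (G - t^k))`.
    have h := ((hC.kronecker hGp).add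
      (((Matrix.PosSemidef.one (n := e) (R := ℂ)).kronecker ih).smul ht)).submatrix
        fun a : Fin (k + 1) → e => (a 0, Fin.tail a)
    refine Eq.subst (motive := Matrix.PosSemidef) ?_ h
    ext a b
    have hab : (a = b) ↔ (a 0 = b 0 ∧ Fin.tail a = Fin.tail b) := by
      constructor
      · rintro rfl; simp
      · rintro ⟨h0, h1⟩
        rw [← Fin.cons_self_tail a, ← Fin.cons_self_tail b, h0, h1]
    simp only [Matrix.sub_apply, Matrix.of_apply, Fin.prod_univ_succ, Matrix.smul_apply,
      Matrix.one_apply, Matrix.submatrix_apply, Matrix.add_apply, Matrix.kroneckerMap_apply, hG,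
      hab, Complex.real_smul]
    by_cases h0 : a 0 = b 0 <;> by_cases h1 : Fin.tail a = Fin.tail b <;>
      simp [h0, h1, Fin.tail] <;> ring

theorem trace_tensorPower_single_mul {d : Type*} [Fintype d] [DecidableEq d] (Φ : SuperOp d)
    {k : ℕ} (a b i j : Fin k → d) :
    ((tensorPower Φ k (Matrix.single a b 1)).conjTranspose *
      tensorPower Φ k (Matrix.single i j 1)).trace =
      ∏ l, choi (hsAdjoint Φ ∘ₗ Φ) (a l, i l) (b l, j l) := by
  simp only [choi_hsAdjoint_comp_apply, Matrix.trace, Matrix.diag_apply, Matrix.mul_apply,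
    Matrix.conjTranspose_apply, tensorPower_single, star_prod, ← Finset.prod_mul_distrib,
    Finset.prod_univ_sum, Fintype.piFinset_univ]

/-- The `k`-th tensor power of the Choi matrix of `Φ† ∘ Φ`. -/
def choiPower {d : Type*} [Fintype d] [DecidableEq d] (Φ : SuperOp d) (k : ℕ) :
    Matrix (Fin k → d × d) (Fin k → d × d) ℂ :=
  Matrix.of fun a b => ∏ l, choi (hsAdjoint Φ ∘ₗ Φ) (a l) (b l)

/-- Pairing the entries of two multi-indices. -/
def zipIndex {d : Type*} {k : ℕ} (p : (Fin k → d) × (Fin k → d)) : Fin k → d × d :=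
  fun l => (p.1 l, p.2 l)

theorem zipIndex_injective {d : Type*} {k : ℕ} :
    Function.Injective (zipIndex (d := d) (k := k)) := by
  intro p q h
  refine Prod.ext (funext fun l => ?_) (funext fun l => ?_)
  · exact congrArg Prod.fst (congrFun h l)
  · exact congrArg Prod.snd (congrFun h l)

theorem trace_tensorPower_mul_eq {d : Type*} [Fintype d] [DecidableEq d] (Φ : SuperOp d)
    {k : ℕ} (X Y : Matrix (Fin k → d) (Fin k → d) ℂ) (hY : Y.IsHermitian) :
    ((tensorPower Φ k Y).conjTranspose * tensorPower Φ k X).trace =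
      (((choiPower Φ k).submatrix zipIndex zipIndex).transpose *
        (Y.transpose ⊗ₖ X)).trace := by
  have h1 : ((tensorPower Φ k Y).conjTranspose * tensorPower Φ k X).trace =
      ∑ a, ∑ b, ∑ i, ∑ j, star (Y a b) * X i j * choiPower Φ k (zipIndex (a, i))
        (zipIndex (b, j)) := by
    rw [map_eq_sum_single (tensorPower Φ k) Y]
    simp only [Matrix.conjTranspose_sum, Matrix.sum_mul, Matrix.trace_sum]
    refine Finset.sum_congr rfl fun a _ => Finset.sum_congr rfl fun b _ => ?_
    rw [map_eq_sum_single (tensorPower Φ k) X]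
    simp only [Matrix.trace_sum, Matrix.conjTranspose_smul, Matrix.smul_mul,
      Matrix.mul_smul, Matrix.trace_smul, trace_tensorPower_single_mul, smul_eq_mul,
      Finset.mul_sum]
    refine Finset.sum_congr rfl fun i _ => Finset.sum_congr rfl fun j _ => ?_
    rw [← mul_assoc, mul_comm (X i j)]
    rfl
  rw [h1, Matrix.trace]
  simp only [Matrix.diag_apply, Matrix.mul_apply, Matrix.transpose_apply, Matrix.submatrix_apply,
    Matrix.kroneckerMap_apply, Fintype.sum_prod_type]
  have h2 : ∀ a b, star (Y a b) = Y b a := fun a b => hY.apply b a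
  simp only [h2]
  rw [Finset.sum_comm]
  refine Finset.sum_congr rfl fun b _ => ?_
  refine (Finset.sum_congr rfl fun a _ => Finset.sum_comm).trans ?_
  rw [Finset.sum_comm]
  refine Finset.sum_congr rfl fun j _ => Finset.sum_congr rfl fun a _ =>
    Finset.sum_congr rfl fun i _ => ?_
  ring

/-- The overlap of two outputs of a tensor power is bounded below through the smallest eigenvalue
of the Choi matrix of `Φ† ∘ Φ`. -/
theorem pow_le_trace_tensorPower_mul {m : ℕ} [NeZero m] {Φ : SuperOp (Fin m)}
    (hΦ : IsChannel Φ) {k : ℕ} {ρ σ : Matrix (Fin k → Fin m) (Fin k → Fin m) ℂ}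
    (hρ : IsState ρ) (hσ : IsState σ) :
    minEigenvalue (choi (hsAdjoint Φ ∘ₗ Φ)) ^ k ≤
      (tensorPower Φ k ρ * tensorPower Φ k σ).trace.re := by
  have hC := choi_hsAdjoint_comp_posSemidef hΦ
  have h1 := ((prod_sub_pow_posSemidef (minEigenvalue_nonneg hC)
    (sub_minEigenvalue_posSemidef hC.1) k).submatrix (zipIndex (d := Fin m))).transpose
  have h2 := trace_mul_re_nonneg h1 (hρ.1.transpose.kronecker hσ.1)
  have h3 := trace_tensorPower_mul_eq Φ σ ρ hρ.1.1
  rw [(((tensorPower_isPositiveTP hΦ k).1 ρ hρ.1).1).eq] at h3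
  rw [h3]
  have h4 : ((choiPower Φ k - minEigenvalue (choi (hsAdjoint Φ ∘ₗ Φ)) ^ k •
      (1 : Matrix (Fin k → Fin m × Fin m) (Fin k → Fin m × Fin m) ℂ)).submatrix
        zipIndex zipIndex).transpose =
      ((choiPower Φ k).submatrix zipIndex zipIndex).transpose -
        minEigenvalue (choi (hsAdjoint Φ ∘ₗ Φ)) ^ k • 1 := by
    have := Matrix.submatrix_one (α := ℂ) _ (zipIndex_injective (d := Fin m) (k := k))
    rw [← Matrix.transpose_one, ← this]
    rfl
  rw [← choiPower, h4, Matrix.sub_mul, Matrix.trace_sub, Complex.sub_re, Matrix.smul_mul,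
    Matrix.one_mul, Matrix.trace_smul, Matrix.trace_kronecker, Matrix.trace_transpose, hρ.2,
    hσ.2, mul_one, Complex.real_smul, mul_one, Complex.ofReal_re] at h2
  linarith

/-- The overlap bound for `k = 1` and equal inputs, with the overlap at most one by the fidelity
bound for the trivial effect `M = 1`. -/
theorem minEigenvalue_le_one {m : ℕ} [NeZero m] {Φ : SuperOp (Fin m)} (hΦ : IsChannel Φ) :
    minEigenvalue (choi (hsAdjoint Φ ∘ₗ Φ)) ≤ 1 := by
  have hs : IsState (Matrix.single (fun _ : Fin 1 => (0 : Fin m)) (fun _ => 0) (1 : ℂ)) := by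
    refine ⟨?_, Matrix.trace_single_eq_same _ _⟩
    have := Matrix.posSemidef_vecMulVec_self_star
      (Pi.single (fun _ : Fin 1 => (0 : Fin m)) (1 : ℂ))
    simpa [← Matrix.single_eq_single_vecMulVec_single] using this
  have hT := (tensorPower_isPositiveTP hΦ 1).isState hs
  have h := pow_le_trace_tensorPower_mul hΦ hs hs
  obtain ⟨a, b, a', b', -, -, -, -, ha, hb, ha', hb', h'⟩ := trace_mul_le_classical_fidelity
    hT.1 hT.1 Matrix.PosSemidef.one (by simpa using Matrix.PosSemidef.zero)
  simp only [Matrix.one_mul, hT.2, Complex.one_re, sub_self, Matrix.zero_mul, Matrix.trace_zero,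
    Complex.zero_re] at ha hb ha' hb'
  rw [pow_eq_zero_iff two_ne_zero] at ha' hb'
  rw [pow_one] at h
  rw [ha', hb', mul_zero, add_zero, mul_pow, ha, hb] at h'
  linarith

/-! ### Non-unital qubit channels -/

theorem trace_zero_mul_add_mul {A B : Matrix (Fin 2) (Fin 2) ℂ} (hA : A.trace = 0)
    (hB : B.trace = 0) : A * B + B * A = (A * B).trace • (1 : Matrix (Fin 2) (Fin 2) ℂ) := by
  rw [Matrix.trace_fin_two] at hA hB
  have h1 : A 1 1 = - A 0 0 := by linear_combination hA
  have h2 : B 1 1 = - B 0 0 := by linear_combination hB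
  ext i j
  fin_cases i <;> fin_cases j <;>
    simp [Matrix.mul_apply, Fin.sum_univ_two, Matrix.trace_fin_two, h1, h2] <;> ring

theorem kraus_sum_conjTranspose_mul {ι : Type*} [Fintype ι] {d : Type*} [Fintype d]
    [DecidableEq d] {Φ : SuperOp d} {K : ι → Matrix d d ℂ}
    (hK : ∀ X, Φ X = ∑ r, K r * X * (K r).conjTranspose) (hΦ : ∀ X, (Φ X).trace = X.trace) :
    ∑ r, (K r).conjTranspose * K r = 1 := by
  refine Matrix.ext_iff_trace_mul_right.2 fun X => ?_
  rw [Matrix.sum_mul, Matrix.trace_sum, Matrix.one_mul, ← hΦ, hK, Matrix.trace_sum]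
  refine Finset.sum_congr rfl fun r _ => ?_
  rw [Matrix.trace_mul_comm (K r * X), Matrix.mul_assoc]

/-- A qubit channel whose Kraus products `K_s† K_r` do not span all matrices is unital. -/
theorem map_one_eq_one_of_trace_eq_zero {ι : Type*} [Fintype ι]
    {Φ : SuperOp (Fin 2)} {K : ι → Matrix (Fin 2) (Fin 2) ℂ}
    (hK : ∀ X, Φ X = ∑ r, K r * X * (K r).conjTranspose) (hΦ : ∀ X, (Φ X).trace = X.trace)
    {X : Matrix (Fin 2) (Fin 2) ℂ} (hX0 : X ≠ 0)
    (hX : ∀ r s, (K r * X * (K s).conjTranspose).trace = 0) : Φ 1 = 1 := by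
  have hsum := kraus_sum_conjTranspose_mul hK hΦ
  have hXt : X.trace = 0 := by
    rw [← hΦ, hK, Matrix.trace_sum]
    exact Finset.sum_eq_zero fun r _ => hX r r
  have hXs : X.conjTranspose.trace = 0 := by rw [Matrix.trace_conjTranspose, hXt, star_zero]
  have hX' : ∀ r s, (K s * X.conjTranspose * (K r).conjTranspose).trace = 0 := by
    intro r s
    rw [← star_eq_zero, ← Matrix.trace_conjTranspose, ← hX r s]
    simp [Matrix.mul_assoc]
  have key : ∀ Y Z : Matrix (Fin 2) (Fin 2) ℂ,
      ∑ r, ∑ s, (K r * Y * (K s).conjTranspose) * (K s * Z * (K r).conjTranspose) =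
        Φ (Y * Z) := by
    intro Y Z
    rw [hK]
    refine Finset.sum_congr rfl fun r _ => ?_
    calc _ = ∑ s, K r * Y * ((K s).conjTranspose * K s) * (Z * (K r).conjTranspose) := by
          simp only [Matrix.mul_assoc]
      _ = _ := by
          rw [← Matrix.sum_mul, ← Matrix.mul_sum, hsum]
          simp only [Matrix.mul_assoc, Matrix.mul_one]
  have h1 : ∃ c : ℂ, Φ (X * X.conjTranspose) + Φ (X.conjTranspose * X) = c • 1 := by
    -- Exchanging `r` and `s` in the second sum pairs each `AB` with its `BA`, where `A = K_r X
    -- K_s†` and `B = K_s X† K_r†` are traceless.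
    rw [← key, ← key, Finset.sum_comm (f := fun r s => K r * X.conjTranspose *
      (K s).conjTranspose * (K s * X * (K r).conjTranspose)), ← Finset.sum_add_distrib]
    simp only [← Finset.sum_add_distrib, trace_zero_mul_add_mul (hX _ _) (hX' _ _),
      ← Finset.sum_smul]
    exact ⟨_, rfl⟩
  obtain ⟨c, hc⟩ := h1
  have hne : (X * X.conjTranspose).trace ≠ 0 :=
    fun h => hX0 (Matrix.trace_mul_conjTranspose_self_eq_zero_iff.1 h)
  rw [← map_add, trace_zero_mul_add_mul hXt hXs, map_smul] at hc
  have h2 : Φ 1 = ((X * X.conjTranspose).trace⁻¹ * c) • (1 : Matrix (Fin 2) (Fin 2) ℂ) := by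
    rw [mul_smul, ← hc, smul_smul, inv_mul_cancel₀ hne, one_smul]
  have h3 := hΦ 1
  rw [h2, Matrix.trace_smul, smul_eq_mul] at h3
  have h4 : (1 : Matrix (Fin 2) (Fin 2) ℂ).trace ≠ 0 := by simp
  rw [h2, mul_eq_right₀ h4 |>.1 h3, one_smul]

theorem minEigenvalue_pos_of_nonunital {Φ : SuperOp (Fin 2)} (hΦ : IsChannel Φ)
    (h : Φ 1 ≠ 1) : 0 < minEigenvalue (choi (hsAdjoint Φ ∘ₗ Φ)) := by
  obtain ⟨K, hK⟩ := hΦ.1.exists_kraus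
  have hC := choi_hsAdjoint_comp_posSemidef hΦ
  refine lt_of_le_of_ne (minEigenvalue_nonneg hC) fun h0 => h ?_
  have hmem := (isLeast_minEigenvalue _ hC.1).1
  rw [← h0, spectrum.zero_mem_iff, Matrix.isUnit_iff_isUnit_det, isUnit_iff_ne_zero,
    not_not] at hmem
  obtain ⟨x, hx0, hx⟩ := Matrix.exists_mulVec_eq_zero_iff.2 hmem
  have h1 : star x ⬝ᵥ (choi (hsAdjoint Φ ∘ₗ Φ)).mulVec x = 0 := by rw [hx, dotProduct_zero]
  -- The quadratic form at `x` is a sum of squared moduli of inner products with the vectorised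
  -- `K_r† K_s`, so each one vanishes.
  have hL : ∀ r s,
      (star fun p : Fin 2 × Fin 2 => ((K r).conjTranspose * K s) p.1 p.2) ⬝ᵥ x = 0 := by
    rw [choi_hsAdjoint_comp_eq_sum hK] at h1
    have h2 : ∀ v : Fin 2 × Fin 2 → ℂ, star x ⬝ᵥ (Matrix.vecMulVec v (star v)).mulVec x =
        (Complex.normSq (star v ⬝ᵥ x) : ℂ) := by
      intro v
      rw [Matrix.vecMulVec_mulVec, Complex.normSq_eq_conj_mul_self, ← Complex.star_def,
        ← Matrix.star_dotProduct_star, star_star]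
      simp [dotProduct_smul, mul_comm]
    simp only [Matrix.sum_mulVec, dotProduct_sum, h2, ← Complex.ofReal_sum,
      Complex.ofReal_eq_zero] at h1
    intro r s
    rw [Finset.sum_eq_zero_iff_of_nonneg fun r _ => Finset.sum_nonneg fun s _ =>
      Complex.normSq_nonneg _] at h1
    have h3 := h1 r (Finset.mem_univ _)
    rw [Finset.sum_eq_zero_iff_of_nonneg fun s _ => Complex.normSq_nonneg _] at h3
    exact Complex.normSq_eq_zero.1 (h3 s (Finset.mem_univ _))
  refine map_one_eq_one_of_trace_eq_zero (X := Matrix.of fun a i => x (a, i)) hK hΦ.2 ?_ ?_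
  · intro h
    exact hx0 (funext fun p => congrFun (congrFun h p.1) p.2)
  · intro r s
    rw [Matrix.trace_mul_comm, ← Matrix.mul_assoc, ← hL r s]
    simp [Matrix.trace, Matrix.mul_apply, dotProduct, Fintype.sum_prod_type, Fin.sum_univ_two]
    ring

/-! ### Contraction factor and layered circuits -/

/-- The contraction factor as a function of `γ` and a lower bound `x` on overlaps of outputs. -/
def contractionBound (γ x : ℝ) : ℝ := 1 / 2 * Real.sqrt ((1 + γ) ^ 2 - 4 * γ * x) + (1 - γ) / 2

theorem contractionBound_nonneg {γ x : ℝ} (hγ : 1 ≤ γ) (hx : x ≤ 1) :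
    0 ≤ contractionBound γ x := by
  have h : γ - 1 ≤ Real.sqrt ((1 + γ) ^ 2 - 4 * γ * x) := Real.le_sqrt_of_sq_le (by nlinarith)
  rw [contractionBound]
  linarith

theorem contractionBound_lt_one {γ x : ℝ} (hγ : 1 ≤ γ) (hx : 0 < x) :
    contractionBound γ x < 1 := by
  have h : Real.sqrt ((1 + γ) ^ 2 - 4 * γ * x) < 1 + γ := by
    rw [Real.sqrt_lt' (by linarith)]
    have : 0 < γ * x := by positivity
    linarith
  rw [contractionBound]
  linarith

theorem hockeyStick_tensorPower_le {m : ℕ} [NeZero m] {Φ : SuperOp (Fin m)} (hΦ : IsChannel Φ)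
    {k : ℕ} {γ x : ℝ} (hγ : 1 ≤ γ) (hx : x ≤ minEigenvalue (choi (hsAdjoint Φ ∘ₗ Φ)) ^ k)
    {ρ σ : Matrix (Fin k → Fin m) (Fin k → Fin m) ℂ} (hρ : IsState ρ) (hσ : IsState σ) :
    hockeyStick γ (tensorPower Φ k ρ) (tensorPower Φ k σ) ≤
      contractionBound γ x * hockeyStick γ ρ σ := by
  have hT := tensorPower_isPositiveTP hΦ k
  exact hockeyStick_map_le hT hγ (fun ρ σ M hρ hσ hM hM' => effect_trace_sub_le (hT.isState hρ)
    (hT.isState hσ) hM hM' (by linarith) (hx.trans (pow_le_trace_tensorPower_mul hΦ hρ hσ)))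
    hρ hσ

theorem layered_isPositiveTP {d : Type*} [Fintype d] {T : SuperOp d} (hT : IsPositiveTP T)
    {C : ℕ → SuperOp d} {n : ℕ} (hC : ∀ i < n, IsPositiveTP (C i)) :
    IsPositiveTP (layered T C n) := by
  induction n with
  | zero => exact ⟨fun X hX => hX, fun X => rfl⟩
  | succ n ih =>
    have h := ih fun i hi => hC i (by omega)
    have hn := hC n (by omega)
    exact ⟨fun X hX => hT.1 _ (hn.1 _ (h.1 _ hX)),
      fun X => (hT.2 _).trans ((hn.2 _).trans (h.2 _))⟩

theorem hockeyStick_layered_le {d : Type*} [Fintype d] [DecidableEq d] {T : SuperOp d}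
    (hT : IsPositiveTP T) {γ c : ℝ} (hγ : 1 ≤ γ) (hc0 : 0 ≤ c)
    (hc : ∀ ρ σ : Matrix d d ℂ, IsState ρ → IsState σ →
      hockeyStick γ (T ρ) (T σ) ≤ c * hockeyStick γ ρ σ)
    {C : ℕ → SuperOp d} {n : ℕ} (hC : ∀ i < n, IsPositiveTP (C i))
    {ρ σ : Matrix d d ℂ} (hρ : IsState ρ) (hσ : IsState σ) :
    hockeyStick γ (layered T C n ρ) (layered T C n σ) ≤ c ^ n * hockeyStick γ ρ σ := by
  induction n with
  | zero => simp [layered]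
  | succ n ih =>
    have hC' : ∀ i < n, IsPositiveTP (C i) := fun i hi => hC i (by omega)
    have hn := hC n (by omega)
    have hl := layered_isPositiveTP hT hC'
    calc hockeyStick γ (layered T C (n + 1) ρ) (layered T C (n + 1) σ)
        ≤ c * hockeyStick γ (C n (layered T C n ρ)) (C n (layered T C n σ)) :=
          hc _ _ (hn.isState (hl.isState hρ)) (hn.isState (hl.isState hσ))
      _ ≤ c * (c ^ n * hockeyStick γ ρ σ) := mul_le_mul_of_nonneg_left
          ((hockeyStick_map_le_self hn hγ (hl.isState hρ) (hl.isState hσ)).trans (ih hC')) hc0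
      _ = c ^ (n + 1) * hockeyStick γ ρ σ := by ring

end QPrivacy

end

theorem mainTheorem10 (N : QPrivacy.SuperOp (Fin 2)) (hN : QPrivacy.IsChannel N) (lam : ℝ)
    (hlam : lam = QPrivacy.minEigenvalue
      (QPrivacy.choi (QPrivacy.hsAdjoint N ∘ₗ N))) :
    -- the contraction bound for the `k`-fold tensor power
    (∀ (k : ℕ) (γ : ℝ), 1 ≤ γ →
      BddAbove (QPrivacy.contractionRatios γ (QPrivacy.tensorPower N k)) ∧
      QPrivacy.contractionCoeff γ (QPrivacy.tensorPower N k) ≤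
        1 / 2 * Real.sqrt ((1 + γ) ^ 2 - 4 * γ * (lam / 4) ^ k) + (1 - γ) / 2) ∧
    -- positivity for non-unital channels
    (N 1 ≠ 1 → 0 < lam) ∧
    -- privacy of noisy circuits of depth `n`
    (∀ (k : ℕ) (ε κ : ℝ), 0 ≤ ε →
      ∀ D : Set (Matrix (Fin k → Fin 2) (Fin k → Fin 2) ℂ), (∀ ρ ∈ D, QPrivacy.IsState ρ) →
      ∀ (n : ℕ) (C : ℕ → QPrivacy.SuperOp (Fin k → Fin 2)), (∀ i < n, QPrivacy.IsChannel (C i)) →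
        QPrivacy.IsDifferentiallyPrivate D
          (fun ρ σ => 1 / 2 * QPrivacy.traceNorm (ρ - σ) ≤ κ) ε
          ((1 / 2 * Real.sqrt ((1 + Real.exp ε) ^ 2 - 4 * Real.exp ε * (lam / 4) ^ k)
            + (1 - Real.exp ε) / 2) ^ n * κ)
          (QPrivacy.layered (QPrivacy.tensorPower N k) C n)) ∧
    -- the decay in the depth is exponential for non-unital channels
    (N 1 ≠ 1 → ∀ (k : ℕ) (ε : ℝ), 0 ≤ ε →
      1 / 2 * Real.sqrt ((1 + Real.exp ε) ^ 2 - 4 * Real.exp ε * (lam / 4) ^ k)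
        + (1 - Real.exp ε) / 2 ∈ Set.Ico (0 : ℝ) 1) := by
  open QPrivacy in
  have h0 : 0 ≤ lam := hlam ▸ minEigenvalue_nonneg (choi_hsAdjoint_comp_posSemidef hN)
  have h1 : lam ≤ 1 := hlam ▸ minEigenvalue_le_one hN
  -- The overlap bound holds with `λ^k`; the factor `1/4` is only a weakening.
  have hx : ∀ k, (lam / 4) ^ k ≤ minEigenvalue (choi (hsAdjoint N ∘ₗ N)) ^ k := fun k => by
    rw [← hlam]
    exact pow_le_pow_left₀ (by positivity) (by linarith) k
  have hx1 : ∀ k, (lam / 4) ^ k ≤ 1 := fun k => pow_le_one₀ (by positivity) (by linarith)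
  have hpos : N 1 ≠ 1 → 0 < lam := fun h => hlam ▸ minEigenvalue_pos_of_nonunital hN h
  refine ⟨fun k γ hγ => ?_, hpos, ?_, fun h k ε hε => ?_⟩
  · have hub : ∀ r ∈ contractionRatios γ (tensorPower N k),
        r ≤ contractionBound γ ((lam / 4) ^ k) := by
      rintro r ⟨ρ, σ, hρ, hσ, hne, rfl⟩
      rw [div_le_iff₀ (lt_of_le_of_ne (hockeyStick_nonneg γ ρ σ) hne.symm)]
      exact hockeyStick_tensorPower_le hN hγ (hx k) hρ hσ
    -- Nonnegativity of the bound covers an empty set of ratios, as occurs for `k = 0`.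
    exact ⟨⟨_, hub⟩, Real.sSup_le hub (contractionBound_nonneg hγ (hx1 k))⟩
  · intro k ε κ hε D hD n C hC M hM hM' ρ hρ σ hσ hn
    have hγ : 1 ≤ Real.exp ε := Real.one_le_exp hε
    have hT := tensorPower_isPositiveTP hN k
    have hC' : ∀ i < n, IsPositiveTP (C i) := fun i hi => (hC i hi).isPositiveTP
    have hL := layered_isPositiveTP hT hC'
    have hb := contractionBound_nonneg hγ (hx1 k)
    have h2 := trace_effect_sub_le_hockeyStick (hL.isState (hD ρ hρ)) (hL.isState (hD σ hσ))
      hM hM' (Real.exp ε)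
    have h3 := hockeyStick_layered_le hT hγ hb (fun ρ σ hρ hσ =>
      hockeyStick_tensorPower_le hN hγ (hx k) hρ hσ) hC' (hD ρ hρ) (hD σ hσ)
    have h4 := mul_le_mul_of_nonneg_left
      ((hockeyStick_le_half_traceNorm hγ (hD ρ hρ) (hD σ hσ)).trans hn) (pow_nonneg hb n)
    rw [← sub_le_iff_le_add']
    exact h2.trans (h3.trans h4)
  · have hγ : 1 ≤ Real.exp ε := Real.one_le_exp hε
    have := hpos h
    exact ⟨contractionBound_nonneg hγ (hx1 k), contractionBound_lt_one hγ (by positivity)⟩
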